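/- Let $N,T,I,K$ be natural numbers with $I\ge 1$; indices run over prosumers $n\le N$, periods $t\le T$ and samples $i\le I$. Fix a norm $\|\cdot\|$ on $\mathbb R^T$ with dual norm $\|a\|_*=\sup\{a^\top x:\|x\|\le 1\}$, a polytope $\Xi=\{\xi\in\mathbb R^T: C\xi\le d\}$ with $C\in\mathbb R^{K\times T}$, $d\in\mathbb R^K$ (it may be unbounded), samples $\hat\xi_{n,i}\in\Xi$, a radius $\rho\ge 0$ and risk levels $\varepsilon_n\in(0,1)$. For each $n$ let $\hat P_n=\frac1I\sum_{i=1}^I\delta_{\hat\xi_{n,i}}$ and let $\mathcal P_n$ be the set of all probability measures $P$ on $\mathbb R^T$ with $P(\Xi)=1$ and $W(P,\hat P_n)\le\rho$, where $W(P,Q)=\inf_\Pi\int\|\xi-\bar\xi\|\,\Pi(d\xi,d\bar\xi)$ over all joint distributions $\Pi$ with marginals $P$ and $Q$. For a loss $L$ put $P\text{-CVaR}_\varepsilon[L]=\inf_{\beta\in\mathbb R}\{\beta+\frac1\varepsilon\mathbb E_P[(L-\beta)_+]\}$. Let $D_n\in\mathbb R^{T\times T}$ be diagonal with diagonal entries $D_{n,t}$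 (its $t$-th row, as a vector, is $D_{n,t}e_t$), let $\mu_n,p_n,q_n,p_n^b,p_n^s,P_n^e\in\mathbb R^T$, and write $x_{n,t}=p_{n,t}+q_{n,t}+p^b_{n,t}-p^s_{n,t}+P^e_{n,t}$. Then for every $n$ and $t$ the worst-case CVaR constraint $$\sup_{P\in\mathcal P_n}P\text{-CVaR}_{\varepsilon_n}\big[D_{n,t}(\mu_{n,t}+\xi_t)-x_{n,t}\big]\le 0\qquad(15)$$ holds if and only if there are $\tau_{n,t},\lambda_{n,t}\in\mathbb R$, $s_{n,i,t}\in\mathbb R$ and $\gamma_{n,i,t}\in\mathbb R^K$ ($i\le I$) such that $$\lambda_{n,t}\,\rho+\frac1I\sum_{i=1}^I s_{n,i,t}\le 0$$ and, for all $i\le I$, $$\tau_{n,t}\le s_{n,i,t},$$ $$D_{n,t}\hat\xi_{n,i,t}+D_{n,t}\mu_{n,t}-x_{n,t}+(\varepsilon_n-1)\tau_{n,t}+\varepsilon_n\gamma_{n,i,t}^\top(d-C\hat\xi_{n,i})\le\varepsilon_n s_{n,i,t},$$ $$\|\varepsilon_nC^\top\gamma_{n,i,t}-D_{n,t}e_t\|_*\le\varepsilon_n\lambda_{n,t},\qquad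 \gamma_{n,i,t}\ge 0.$$ Consequently the constraints (15) hold for all $n,t$ simultaneously if and only if there are arrays $\tau,\lambda\in\mathbb R^{N\times T}$, $s\in\mathbb R^{N\times I\times T}$, $\gamma\in(\mathbb R_+^{K})^{N\times I\times T}$ that satisfy these constraints (14b) for all $n,i,t$. -/

import Mathlib

open MeasureTheory Matrix
open scoped ENNReal

noncomputable section

namespace WorstCaseCVaR

/-- The dual norm `‖a‖_* = sup {⟨a, x⟩ : ‖x‖ ≤ 1}` of a norm `nrm` on `ℝ^T`. -/
def dualNorm {T : ℕ} (nrm : Seminorm ℝ (Fin T → ℝ)) (a : Fin T → ℝ) : ℝ :=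
  sSup {r : ℝ | ∃ x : Fin T → ℝ, nrm x ≤ 1 ∧ r = a ⬝ᵥ x}

/-- The polytope `Ξ = {ξ : C ξ ≤ d}`. -/
def polytope {T K : ℕ} (C : Matrix (Fin K) (Fin T) ℝ) (d : Fin K → ℝ) :
    Set (Fin T → ℝ) :=
  {x | C *ᵥ x ≤ d}

/-- The empirical distribution `I⁻¹ ∑ i, δ_{ξ̂ i}` of the samples `ξ̂ 1, …, ξ̂ I`. -/
def empirical {T I : ℕ} (xiHat : Fin I → Fin T → ℝ) : Measure (Fin T → ℝ) :=
  (I : ℝ≥0∞)⁻¹ • ∑ i, Measure.dirac (xiHat i)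

/-- The (order one) Wasserstein distance of `P` and `Q` for the norm `nrm`: the infimum of the
transport cost over all joint distributions with marginals `P` and `Q`. -/
def wasserstein {T : ℕ} (nrm : Seminorm ℝ (Fin T → ℝ)) (P Q : Measure (Fin T → ℝ)) : ℝ≥0∞ :=
  ⨅ π ∈ {π : Measure ((Fin T → ℝ) × (Fin T → ℝ)) |
      π.map Prod.fst = P ∧ π.map Prod.snd = Q},
    ∫⁻ z, ENNReal.ofReal (nrm (z.1 - z.2)) ∂π

/-- The Wasserstein ambiguity ball of radius `ρ` around the empirical distribution: all
probability distributions supported on `Ξ` at distance at most `ρ` from it. -/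
def ambiguitySet {T I : ℕ} (nrm : Seminorm ℝ (Fin T → ℝ)) (Ξ : Set (Fin T → ℝ))
    (xiHat : Fin I → Fin T → ℝ) (ρ : ℝ) : Set (Measure (Fin T → ℝ)) :=
  {P | IsProbabilityMeasure P ∧ P Ξᶜ = 0 ∧
    wasserstein nrm P (empirical xiHat) ≤ ENNReal.ofReal ρ}

/-- The conditional value-at-risk at level `ε` of the loss `L` under `P`,
`inf_β {β + ε⁻¹ E_P [(L - β)₊]}`, with values in the extended reals. -/
def cvar {Ω : Type*} [MeasurableSpace Ω] (P : Measure Ω) (ε : ℝ) (L : Ω → ℝ) : EReal :=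
  ⨅ β : ℝ, (β : EReal) +
    (((ENNReal.ofReal ε)⁻¹ * ∫⁻ ω, ENNReal.ofReal (L ω - β) ∂P : ℝ≥0∞) : EReal)

/-- The worst-case conditional value-at-risk over a set `𝒫` of distributions. -/
def worstCaseCVaR {Ω : Type*} [MeasurableSpace Ω] (A : Set (Measure Ω)) (ε : ℝ) (L : Ω → ℝ) :
    EReal :=
  ⨆ P ∈ A, cvar P ε L

/-- The conic constraints, for one prosumer and one period `t`, on the auxiliary variables
`τ`, `lam`, `s`, `γ`. Here `D` is the vector of diagonal entries of the (diagonal) matrix of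
nominal powers, so that `Matrix.diagonal D t` is its row `t`, and `x` stands for
`p + q + p^b - p^s + P^e` in period `t`. -/
def ConicConstraints {T I K : ℕ} (nrm : Seminorm ℝ (Fin T → ℝ))
    (C : Matrix (Fin K) (Fin T) ℝ) (d : Fin K → ℝ) (xiHat : Fin I → Fin T → ℝ) (ρ ε : ℝ)
    (D μ : Fin T → ℝ) (x : ℝ) (t : Fin T)
    (τ lam : ℝ) (s : Fin I → ℝ) (γ : Fin I → Fin K → ℝ) : Prop :=
  lam * ρ + (1 / (I : ℝ)) * ∑ i, s i ≤ 0 ∧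
  ∀ i : Fin I,
    τ ≤ s i ∧
    D t * xiHat i t + D t * μ t - x + (ε - 1) * τ + ε * (γ i ⬝ᵥ (d - C *ᵥ xiHat i))
      ≤ ε * s i ∧
    dualNorm nrm (ε • (Cᵀ *ᵥ γ i) - Matrix.diagonal D t) ≤ ε * lam ∧
    0 ≤ γ i

end WorstCaseCVaR

end

/-!
Write `b i = d - C (xiHat i) ≥ 0`, and let `ℓ i` be the loss at the sample `xiHat i`. The loss is
affine with slope `δ = D t` in the coordinate `t`.

*The constraints bound the worst case.* Put `β = τ` in the definition of the conditional
value-at-risk. By the definition of the dual norm and `C ξ ≤ d`, the constraints for `i` give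
`L(ξ) - τ ≤ ε λ ‖ξ - xiHat i‖ + ε (s i - τ)` for every `ξ` in the polytope
(`ConicConstraints.excess_le`). Integrating this over a coupling of `P` with the empirical
distribution (`lintegral_le_of_coupling`) gives `E_P[(L - τ)₊] ≤ ε (λ ρ + mean s - τ) ≤ -ε τ`.

*A nonpositive worst case provides the variables.* The conditional value-at-risk is at least the
average loss over any part of mass `ε`, so no minimax theorem is needed: it suffices to look at the
distributions that take mass `a i ≤ 1 / I` from the sample `i`, with total `ε`, and move it by
`z i / a i`. The hypothesis thus says that the finite-dimensional problem

  maximize `∑ i, (a i * ℓ i + δ * z i t)` subject to `0 ≤ a i ≤ 1 / I`, `∑ i, a i = ε`,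
  `C (z i) ≤ a i • b i`, `∑ i, ‖z i‖ ≤ ρ`

has value at most `0` (`transportLoss_nonpos`). The conic constraints are those of its dual, up to
a rescaling, so what remains is that the dual optimum is attained. The norm constraint is dualized
first: by Slater's condition if `ρ > 0` (`exists_multiplier_of_seminorm_constraint`), and with
a Lipschitz constant of the loss as the multiplier if `ρ = 0`. The other constraints are linear, and
a Hahn–Banach separation together with Farkas' lemma gives their multipliers without any
interior point (`exists_multipliers_of_sub_seminorm_le`, `exists_transport_multipliers`).
-/

namespace WorstCaseCVaR

/-! ### Linear and convex duality -/

/-- **Farkas' lemma**. By induction on the number of inequalities: a point at which dropping one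
inequality `φ₀ ≤ 0` matters spans a complement of the kernel of `φ₀`, and the other inequalities
are projected along it onto this kernel. -/
lemma exists_nonneg_combination {V ι : Type*} [AddCommGroup V] [Module ℝ V] (s : Finset ι) :
    ∀ (φ : ι → V →ₗ[ℝ] ℝ) (f : V →ₗ[ℝ] ℝ), (∀ x, (∀ k ∈ s, φ k x ≤ 0) → f x ≤ 0) →
      ∃ y : ι → ℝ, (∀ k, 0 ≤ y k) ∧ ∀ x, f x = ∑ k ∈ s, y k * φ k x := by
  classical
  induction s using Finset.induction_on with
  | empty =>
    intro φ f h
    refine ⟨0, fun _ => le_rfl, fun x => ?_⟩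
    have h1 := h x (by simp)
    have h2 := h (-x) (by simp)
    rw [map_neg] at h2
    simp only [Finset.sum_empty]
    linarith
  | insert j s hj ih =>
    intro φ f h
    by_cases hs : ∀ x, (∀ k ∈ s, φ k x ≤ 0) → f x ≤ 0
    · obtain ⟨y, hy, hf⟩ := ih φ f hs
      refine ⟨Function.update y j 0, fun k => ?_, fun x => ?_⟩
      · by_cases hk : k = j
        · subst hk; simp
        · simpa [hk] using hy k
      · rw [Finset.sum_insert hj, hf x]
        simp only [Function.update_self, zero_mul, zero_add]
        refine Finset.sum_congr rfl fun k hk => ?_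
        rw [Function.update_of_ne (ne_of_mem_of_not_mem hk hj)]
    · push Not at hs
      obtain ⟨v, hv, hfv⟩ := hs
      have hjv : 0 < φ j v := by
        by_contra hcon
        refine absurd (h v fun k hk => ?_) (not_le.mpr hfv)
        rcases Finset.mem_insert.mp hk with rfl | hk
        · exact not_lt.mp hcon
        · exact hv k hk
      obtain ⟨y, hy, hf⟩ := ih (fun k => φ k - (φ k v / φ j v) • φ j)
        (f - (f v / φ j v) • φ j) (by
          intro x hx
          have key : ∀ g : V →ₗ[ℝ] ℝ, (g - (g v / φ j v) • φ j) x
              = g (x - (φ j x / φ j v) • v) := by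
            intro g
            simp only [LinearMap.sub_apply, LinearMap.smul_apply, map_sub, map_smul, smul_eq_mul]
            ring
          rw [key]
          refine h _ fun k hk => ?_
          rcases Finset.mem_insert.mp hk with rfl | hk
          · simp only [map_sub, map_smul, smul_eq_mul]
            rw [div_mul_cancel₀ _ hjv.ne', sub_self]
          · rw [← key]; exact hx k hk)
      have hc : 0 ≤ (f v - ∑ k ∈ s, y k * φ k v) / φ j v := by
        refine div_nonneg ?_ hjv.le
        have : ∑ k ∈ s, y k * φ k v ≤ 0 :=
          Finset.sum_nonpos fun k hk => mul_nonpos_of_nonneg_of_nonpos (hy k) (hv k hk)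
        linarith
      refine ⟨Function.update y j ((f v - ∑ k ∈ s, y k * φ k v) / φ j v), fun k => ?_,
        fun x => ?_⟩
      · by_cases hk : k = j
        · subst hk; simpa using hc
        · simpa [hk] using hy k
      · have hfx := hf x
        simp only [LinearMap.sub_apply, LinearMap.smul_apply, smul_eq_mul] at hfx
        have h1 : ∑ k ∈ s, y k * (φ k x - φ k v / φ j v * φ j x)
            = ∑ k ∈ s, y k * φ k x - (∑ k ∈ s, y k * φ k v) / φ j v * φ j x := by
          rw [Finset.sum_div, Finset.sum_mul, ← Finset.sum_sub_distrib]
          exact Finset.sum_congr rfl fun k _ => by ring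
        have h2 : ∑ k ∈ s, Function.update y j ((f v - ∑ k ∈ s, y k * φ k v) / φ j v) k * φ k x
            = ∑ k ∈ s, y k * φ k x := by
          refine Finset.sum_congr rfl fun k hk => ?_
          rw [Function.update_of_ne (ne_of_mem_of_not_mem hk hj)]
        rw [Finset.sum_insert hj, h2, Function.update_self]
        rw [h1] at hfx
        rw [sub_div, sub_mul]
        linarith

/-- The affine form of Farkas' lemma: an inequality that is valid on a nonempty polyhedron is a
nonnegative combination of the defining ones. It is obtained by homogenization. -/
lemma exists_multipliers_of_le_on_polyhedron {V ι : Type*} [AddCommGroup V] [Module ℝ V]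
    [Fintype ι] (φ : ι → V →ₗ[ℝ] ℝ) (c : ι → ℝ) (f : V →ₗ[ℝ] ℝ) (r : ℝ)
    (w₀ : V) (hw₀ : ∀ k, φ k w₀ ≤ c k) (h : ∀ w, (∀ k, φ k w ≤ c k) → f w ≤ r) :
    ∃ y : ι → ℝ, (∀ k, 0 ≤ y k) ∧ (∀ w, f w = ∑ k, y k * φ k w) ∧ ∑ k, y k * c k ≤ r := by
  have hom : ∀ x : V × ℝ, (∀ k, φ k x.1 ≤ c k * x.2) → 0 ≤ x.2 → f x.1 ≤ r * x.2 := by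
    rintro ⟨v, t⟩ hk ht
    simp only at hk ht ⊢
    rcases ht.eq_or_lt with rfl | ht
    · -- `v` is a recession direction of the polyhedron
      by_contra! hcon
      rw [mul_zero] at hcon
      have := h (w₀ + ((r - f w₀ + 1) / f v) • v) fun k => by
        have h1 := hk k
        rw [mul_zero] at h1
        have h2 : 0 ≤ (r - f w₀ + 1) / f v := by
          have := h w₀ hw₀
          exact div_nonneg (by linarith) hcon.le
        rw [map_add, map_smul, smul_eq_mul]
        have := mul_nonpos_of_nonneg_of_nonpos h2 h1
        linarith [hw₀ k]
      rw [map_add, map_smul, smul_eq_mul, div_mul_cancel₀ _ hcon.ne'] at this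
      linarith
    · have := h (t⁻¹ • v) fun k => by
        rw [map_smul, smul_eq_mul, inv_mul_le_iff₀ ht, mul_comm]
        exact hk k
      rwa [map_smul, smul_eq_mul, inv_mul_le_iff₀ ht, mul_comm] at this
  obtain ⟨y, hy, hf⟩ := exists_nonneg_combination (Finset.univ : Finset (Option ι))
    (fun o => o.elim (-LinearMap.snd ℝ V ℝ)
      (fun k => (φ k).comp (LinearMap.fst ℝ V ℝ) - c k • LinearMap.snd ℝ V ℝ))
    (f.comp (LinearMap.fst ℝ V ℝ) - r • LinearMap.snd ℝ V ℝ) (by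
      intro x hx
      have h1 := hom x (fun k => by simpa using hx (some k) (Finset.mem_univ _))
        (by simpa using hx none (Finset.mem_univ _))
      simpa using h1)
  refine ⟨fun k => y (some k), fun k => hy _, fun w => ?_, ?_⟩
  · simpa [Fintype.sum_option] using hf (w, 0)
  · have h1 := hf (0, 1)
    simp [Fintype.sum_option] at h1
    linarith [hy none]

/-- Lagrange duality, with attained multipliers, for the maximization over a polyhedron of a linear
functional minus a multiple of a continuous seminorm. A Hahn–Banach separation replaces the
seminorm term by a linear functional that it dominates, and Farkas' lemma does the rest; as the
constraints are linear, no interior point is needed. -/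
lemma exists_multipliers_of_sub_seminorm_le {E ι : Type*} [AddCommGroup E] [Module ℝ E]
    [TopologicalSpace E] [IsTopologicalAddGroup E] [ContinuousSMul ℝ E] [Fintype ι]
    (p : Seminorm ℝ E) (hp : Continuous p) (lam : ℝ) (hlam : 0 ≤ lam)
    (φ : ι → E →ₗ[ℝ] ℝ) (c : ι → ℝ) (f : E →ₗ[ℝ] ℝ) (r : ℝ)
    (w₀ : E) (hw₀ : ∀ k, φ k w₀ ≤ c k)
    (h : ∀ w, (∀ k, φ k w ≤ c k) → f w - lam * p w ≤ r) :
    ∃ y : ι → ℝ, (∀ k, 0 ≤ y k) ∧ (∀ w, f w - ∑ k, y k * φ k w ≤ lam * p w) ∧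
      ∑ k, y k * c k ≤ r := by
  have hconv : ConvexOn ℝ Set.univ (fun w => lam * p w) := by
    simpa using p.convexOn.smul hlam
  -- The open strict epigraph of the seminorm and the polyhedral hypograph are disjoint.
  obtain ⟨F, u, hFA, hFB⟩ := geometric_hahn_banach_open
    (s := {x : E × ℝ | lam * p x.1 < x.2})
    (t := {x : E × ℝ | (∀ k, φ k x.1 ≤ c k) ∧ x.2 ≤ f x.1 - r})
    (by simpa using hconv.convex_strict_epigraph)
    (isOpen_lt (by fun_prop) (by fun_prop))
    (by
      rintro ⟨v, s⟩ ⟨hv, hs⟩ ⟨v', s'⟩ ⟨hv', hs'⟩ a b ha hb hab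
      simp only at hv hs hv' hs'
      refine ⟨fun k => ?_, ?_⟩
      · simp only [Prod.fst_add, Prod.smul_fst, map_add, map_smul, smul_eq_mul]
        calc a * φ k v + b * φ k v' ≤ a * c k + b * c k := by gcongr <;> simp [hv, hv']
          _ = c k := by rw [← add_mul, hab, one_mul]
      · simp only [Prod.fst_add, Prod.smul_fst, Prod.snd_add, Prod.smul_snd, map_add, map_smul,
          smul_eq_mul]
        calc a * s + b * s' ≤ a * (f v - r) + b * (f v' - r) := by gcongr
          _ = a * f v + b * f v' - (a + b) * r := by ring
          _ = a * f v + b * f v' - r := by rw [hab, one_mul])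
    (by
      rw [Set.disjoint_left]
      rintro ⟨v, s⟩ hA ⟨hB, hs⟩
      simp only [Set.mem_ofPred_eq] at hA hB hs
      have := h v hB
      linarith)
  have hF : ∀ v s, F (v, s) = F (v, 0) + s * F (0, 1) := by
    intro v s
    have : (v, s) = (v, (0 : ℝ)) + s • ((0 : E), (1 : ℝ)) := by simp
    rw [this, map_add, map_smul, smul_eq_mul]
  have hF0 : F (0, 0) = 0 := map_zero F
  have hu : 0 ≤ u := by
    by_contra! hcon
    have h1 : F (0, 1) < u := hFA (0, 1) (by simp)
    have h2 := hFA (0, u / F (0, 1) / 2) (by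
      have : 0 < u / F (0, 1) := div_pos_of_neg_of_neg hcon (h1.trans hcon)
      simp only [Set.mem_ofPred_eq, map_zero, mul_zero]
      linarith)
    rw [hF, hF0] at h2
    have h3 : u / F (0, 1) / 2 * F (0, 1) = u / 2 := by
      field_simp [(h1.trans hcon).ne]
    linarith
  -- The epigraph is a cone, so the functional, being bounded above on it, is nonpositive there.
  have hcone : ∀ v s, lam * p v < s → F (v, s) ≤ 0 := by
    intro v s hvs
    by_contra! hcon
    have hpos : 0 < u / F (v, s) + 1 := by positivity
    have h2 := hFA ((u / F (v, s) + 1) • (v, s)) (by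
      simp only [Set.mem_ofPred_eq, Prod.smul_fst, Prod.smul_snd, map_smul_eq_mul, smul_eq_mul,
        Real.norm_eq_abs, abs_of_pos hpos]
      nlinarith)
    rw [map_smul, smul_eq_mul, add_mul, div_mul_cancel₀ _ hcon.ne'] at h2
    linarith
  have hneg : F (0, 1) < 0 := by
    refine lt_of_le_of_ne (hcone 0 1 (by simp)) fun h0 => ?_
    have h1 : ∀ v, F (v, 0) ≤ 0 := fun v => by
      have := hcone v (lam * p v + 1) (by linarith)
      rwa [hF, h0, mul_zero, add_zero] at this
    have h2 : F (w₀, 0) = 0 := le_antisymm (h1 _) (by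
      have := h1 (-w₀)
      have h3 : ((-w₀, 0) : E × ℝ) = -(w₀, 0) := by simp
      rw [h3, map_neg] at this
      linarith)
    have h4 := hFA (w₀, lam * p w₀ + 1) (by simp)
    have h5 := hFB (w₀, f w₀ - r) ⟨hw₀, le_rfl⟩
    rw [hF, h0, mul_zero, add_zero, h2] at h4 h5
    linarith
  set g : E →ₗ[ℝ] ℝ := (-F (0, 1))⁻¹ • ((F : E × ℝ →ₗ[ℝ] ℝ).comp (LinearMap.inl ℝ E ℝ)) with hg
  have hgF : ∀ v, F (v, 0) = -F (0, 1) * g v := by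
    intro v
    have : g v = (-F (0, 1))⁻¹ * F (v, 0) := rfl
    rw [this, mul_inv_cancel_left₀ (by linarith)]
  have hgp : ∀ v, g v ≤ lam * p v := by
    intro v
    refine le_of_forall_pos_le_add fun δ hδ => ?_
    have h1 := hcone v (lam * p v + δ) (by linarith)
    rw [hF, hgF] at h1
    by_contra! hcon
    nlinarith
  obtain ⟨y, hy, hyf, hyc⟩ := exists_multipliers_of_le_on_polyhedron φ c (f - g) r w₀ hw₀ (by
    intro w hw
    have h1 := hFB (w, f w - r) ⟨hw, le_rfl⟩
    rw [hF, hgF] at h1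
    rw [LinearMap.sub_apply]
    by_contra! hcon
    nlinarith)
  refine ⟨y, hy, fun w => ?_, hyc⟩
  rw [← hyf, LinearMap.sub_apply]
  linarith [hgp w]

/-- A Lagrange multiplier for one seminorm constraint `p w ≤ ρ` over a convex set, under Slater's
condition. -/
lemma exists_multiplier_of_seminorm_constraint {E : Type*} [AddCommGroup E] [Module ℝ E]
    (p : Seminorm ℝ E) (F : Set E) (hF : Convex ℝ F) (f : E →ₗ[ℝ] ℝ) (ρ : ℝ)
    (h : ∀ w ∈ F, p w ≤ ρ → f w ≤ 0) (w₀ : E) (hw₀ : w₀ ∈ F) (hρ : p w₀ < ρ) :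
    ∃ lam : ℝ, 0 ≤ lam ∧ ∀ w ∈ F, f w - lam * p w ≤ -(lam * ρ) := by
  -- the least slope allowed by the points strictly inside the constraint
  set S : Set ℝ := {l | ∃ w ∈ F, p w < ρ ∧ l = -f w / (ρ - p w)} with hS
  have hne : S.Nonempty := ⟨_, w₀, hw₀, hρ, rfl⟩
  have hS0 : ∀ l ∈ S, 0 ≤ l := by
    rintro l ⟨w, hw, hwρ, rfl⟩
    exact div_nonneg (by linarith [h w hw hwρ.le]) (by linarith)
  refine ⟨sInf S, le_csInf hne hS0, fun w hw => ?_⟩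
  rcases lt_trichotomy (p w) ρ with hlt | heq | hgt
  · have h1 : sInf S ≤ -f w / (ρ - p w) := csInf_le ⟨0, hS0⟩ ⟨w, hw, hlt, rfl⟩
    rw [le_div_iff₀ (by linarith)] at h1
    linarith
  · have := h w hw heq.le
    rw [heq]; linarith
  · have h1 : f w / (p w - ρ) ≤ sInf S := by
      refine le_csInf hne ?_
      rintro l ⟨v, hv, hvρ, rfl⟩
      rw [div_le_div_iff₀ (by linarith) (by linarith)]
      -- the point of the segment from `v` to `w` at which the interpolated seminorm is `ρ`
      have hpos : 0 < p w - p v := by linarith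
      have ha : 0 ≤ (p w - ρ) / (p w - p v) := div_nonneg (by linarith) hpos.le
      have hb : 0 ≤ (ρ - p v) / (p w - p v) := div_nonneg (by linarith) hpos.le
      have h2 := h _ (hF hv hw ha hb (by field_simp; ring)) (by
        refine (map_add_le_add p _ _).trans ?_
        rw [map_smul_eq_mul, map_smul_eq_mul, Real.norm_of_nonneg ha, Real.norm_of_nonneg hb]
        refine le_of_eq ?_
        field_simp
        ring)
      rw [map_add, map_smul, map_smul, smul_eq_mul, smul_eq_mul] at h2
      have h3 : ((p w - ρ) * f v + (ρ - p v) * f w) / (p w - p v) ≤ 0 := by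
        refine le_trans (le_of_eq ?_) h2
        ring
      rw [div_le_iff₀ hpos, zero_mul] at h3
      linarith
    rw [div_le_iff₀ (by linarith)] at h1
    linarith

/-! ### Norms on `ℝ^T` and their dual norms -/

lemma continuous_seminorm {T : ℕ} (nrm : Seminorm ℝ (Fin T → ℝ)) : Continuous nrm :=
  nrm.convexOn.locallyLipschitz.continuous

/-- The constant is the inverse of the minimum of `nrm` on the unit sphere of the sup norm. -/
lemma exists_norm_le_mul_seminorm {T : ℕ} (nrm : Seminorm ℝ (Fin T → ℝ))
    (hnrm : ∀ x, nrm x = 0 → x = 0) : ∃ c : ℝ, 0 ≤ c ∧ ∀ x, ‖x‖ ≤ c * nrm x := by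
  rcases (Metric.sphere (0 : Fin T → ℝ) 1).eq_empty_or_nonempty with he | hne
  · refine ⟨0, le_rfl, fun x => ?_⟩
    by_contra! hcon
    rw [zero_mul] at hcon
    have : ‖x‖⁻¹ • x ∈ Metric.sphere (0 : Fin T → ℝ) 1 := by
      rw [mem_sphere_zero_iff_norm, norm_smul, norm_inv, norm_norm, inv_mul_cancel₀ hcon.ne']
    rw [he] at this
    exact this
  · obtain ⟨v, hv, hmin⟩ := (isCompact_sphere (0 : Fin T → ℝ) 1).exists_isMinOn hne
      (continuous_seminorm nrm).continuousOn
    rw [mem_sphere_zero_iff_norm] at hv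
    have hpos : 0 < nrm v := lt_of_le_of_ne (apply_nonneg _ _) fun h0 => by
      rw [hnrm v h0.symm, norm_zero] at hv
      exact zero_ne_one hv
    refine ⟨(nrm v)⁻¹, by positivity, fun x => ?_⟩
    by_cases hx : x = 0
    · simp [hx]
    have hx' : 0 < ‖x‖ := norm_pos_iff.mpr hx
    have h1 : nrm v ≤ nrm (‖x‖⁻¹ • x) := hmin (by
      rw [mem_sphere_zero_iff_norm, norm_smul, norm_inv, norm_norm, inv_mul_cancel₀ hx'.ne'])
    rw [map_smul_eq_mul, norm_inv, norm_norm, le_inv_mul_iff₀ hx'] at h1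
    rw [le_inv_mul_iff₀ hpos]
    linarith

lemma dotProduct_le_dualNorm_mul {T : ℕ} (nrm : Seminorm ℝ (Fin T → ℝ))
    (hnrm : ∀ x, nrm x = 0 → x = 0) (a z : Fin T → ℝ) :
    a ⬝ᵥ z ≤ dualNorm nrm a * nrm z := by
  obtain ⟨c, hc, hcn⟩ := exists_norm_le_mul_seminorm nrm hnrm
  have hbdd : BddAbove {r : ℝ | ∃ x : Fin T → ℝ, nrm x ≤ 1 ∧ r = a ⬝ᵥ x} := by
    refine ⟨∑ i, |a i| * c, ?_⟩
    rintro r ⟨x, hx, rfl⟩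
    refine Finset.sum_le_sum fun i _ => ?_
    calc a i * x i ≤ |a i| * |x i| := by rw [← abs_mul]; exact le_abs_self _
      _ ≤ |a i| * c := by
        gcongr
        calc |x i| ≤ ‖x‖ := norm_le_pi_norm x i
          _ ≤ c * nrm x := hcn x
          _ ≤ c := mul_le_of_le_one_right hc hx
  rcases (apply_nonneg nrm z).eq_or_lt with h0 | hpos
  · simp [hnrm z h0.symm]
  · have : a ⬝ᵥ ((nrm z)⁻¹ • z) ≤ dualNorm nrm a := le_csSup hbdd
      ⟨_, by rw [map_smul_eq_mul, Real.norm_of_nonneg (by positivity), inv_mul_cancel₀ hpos.ne'],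
        rfl⟩
    rwa [dotProduct_smul, smul_eq_mul, inv_mul_le_iff₀ hpos, mul_comm] at this

/-- If the supremum were infinite, then `sSup` would be `0`; so `nrm` need not be definite. -/
lemma dualNorm_nonneg {T : ℕ} (nrm : Seminorm ℝ (Fin T → ℝ)) (a : Fin T → ℝ) :
    0 ≤ dualNorm nrm a := by
  by_cases hbdd : BddAbove {r : ℝ | ∃ x : Fin T → ℝ, nrm x ≤ 1 ∧ r = a ⬝ᵥ x}
  · exact le_csSup hbdd ⟨0, by simp, by simp⟩
  · exact (Real.sSup_of_not_bddAbove hbdd).ge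

lemma dualNorm_le {T : ℕ} (nrm : Seminorm ℝ (Fin T → ℝ)) (a : Fin T → ℝ) (l : ℝ) (hl : 0 ≤ l)
    (h : ∀ x, a ⬝ᵥ x ≤ l * nrm x) : dualNorm nrm a ≤ l := by
  refine csSup_le ⟨0, 0, by simp, by simp⟩ ?_
  rintro r ⟨x, hx, rfl⟩
  exact (h x).trans (mul_le_of_le_one_right hl hx)

/-! ### The conic constraints bound the worst case -/

/-- The pointwise form of weak duality: the constraints for the sample `i` bound the excess loss
at every point of the polytope. -/
lemma ConicConstraints.excess_le {T I K : ℕ} {nrm : Seminorm ℝ (Fin T → ℝ)}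
    (hnrm : ∀ x, nrm x = 0 → x = 0) {C : Matrix (Fin K) (Fin T) ℝ} {d : Fin K → ℝ}
    {xiHat : Fin I → Fin T → ℝ} {ρ ε : ℝ} (hε : 0 < ε) {D μ : Fin T → ℝ} {x : ℝ} {t : Fin T}
    {τ lam : ℝ} {s : Fin I → ℝ} {γ : Fin I → Fin K → ℝ}
    (h : ConicConstraints nrm C d xiHat ρ ε D μ x t τ lam s γ) (i : Fin I)
    (ξ : Fin T → ℝ) (hξ : ξ ∈ polytope C d) :
    D t * (μ t + ξ t) - x - τ ≤ ε * lam * nrm (ξ - xiHat i) + ε * (s i - τ) := by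
  obtain ⟨-, h2, h3, h4⟩ := h.2 i
  have hdual : -((ε • (Cᵀ *ᵥ γ i) - Matrix.diagonal D t) ⬝ᵥ (ξ - xiHat i))
      ≤ ε * lam * nrm (ξ - xiHat i) := by
    have h5 := dotProduct_le_dualNorm_mul nrm hnrm (ε • (Cᵀ *ᵥ γ i) - Matrix.diagonal D t)
      (-(ξ - xiHat i))
    rw [dotProduct_neg, map_neg_eq_map] at h5
    exact h5.trans (mul_le_mul_of_nonneg_right h3 (apply_nonneg _ _))
  have hdiag : Matrix.diagonal D t ⬝ᵥ (ξ - xiHat i) = D t * (ξ t - xiHat i t) := by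
    rw [diagonal_dotProduct]; rfl
  have hC : (Cᵀ *ᵥ γ i) ⬝ᵥ (ξ - xiHat i) ≤ γ i ⬝ᵥ (d - C *ᵥ xiHat i) := by
    rw [Matrix.mulVec_transpose, ← Matrix.dotProduct_mulVec, Matrix.mulVec_sub]
    exact dotProduct_le_dotProduct_of_nonneg_left (sub_le_sub_right hξ _) h4
  rw [sub_dotProduct, smul_dotProduct, smul_eq_mul, hdiag] at hdual
  have := mul_le_mul_of_nonneg_left hC hε.le
  linarith

lemma ConicConstraints.lam_nonneg {T I K : ℕ} {nrm : Seminorm ℝ (Fin T → ℝ)}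
    {C : Matrix (Fin K) (Fin T) ℝ} {d : Fin K → ℝ}
    {xiHat : Fin I → Fin T → ℝ} {ρ ε : ℝ} (hε : 0 < ε) {D μ : Fin T → ℝ} {x : ℝ} {t : Fin T}
    {τ lam : ℝ} {s : Fin I → ℝ} {γ : Fin I → Fin K → ℝ} (hI : 0 < I)
    (h : ConicConstraints nrm C d xiHat ρ ε D μ x t τ lam s γ) : 0 ≤ lam :=
  nonneg_of_mul_nonneg_right ((dualNorm_nonneg _ _).trans (h.2 ⟨0, hI⟩).2.2.1) hε

lemma lintegral_empirical {T I : ℕ} (xiHat : Fin I → Fin T → ℝ) (h : (Fin T → ℝ) → ℝ≥0∞) :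
    ∫⁻ ζ, h ζ ∂(empirical xiHat) = (I : ℝ≥0∞)⁻¹ * ∑ i, h (xiHat i) := by
  rw [empirical, lintegral_smul_measure, lintegral_finsetSum_measure, smul_eq_mul]
  simp only [lintegral_dirac]

/-- An excess loss that is bounded by transport cost plus a constant depending on the sample
integrates to at most the transport cost plus the average of these constants. -/
lemma lintegral_le_of_coupling {T I : ℕ} (nrm : Seminorm ℝ (Fin T → ℝ)) (Ξ : Set (Fin T → ℝ))
    (xiHat : Fin I → Fin T → ℝ) (π : Measure ((Fin T → ℝ) × (Fin T → ℝ)))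
    (hfst : π.map Prod.fst Ξᶜ = 0) (hsnd : π.map Prod.snd = empirical xiHat)
    (f : (Fin T → ℝ) → ℝ≥0∞) (hf : Measurable f) (l : ℝ≥0∞) (c : Fin I → ℝ≥0∞)
    (h : ∀ i, ∀ ξ ∈ Ξ, f ξ ≤ l * ENNReal.ofReal (nrm (ξ - xiHat i)) + c i) :
    ∫⁻ ξ, f ξ ∂(π.map Prod.fst) ≤
      l * ∫⁻ z, ENNReal.ofReal (nrm (z.1 - z.2)) ∂π + (I : ℝ≥0∞)⁻¹ * ∑ i, c i := by
  have hn : Measurable fun z : (Fin T → ℝ) × (Fin T → ℝ) => ENNReal.ofReal (nrm (z.1 - z.2)) :=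
    ENNReal.measurable_ofReal.comp ((continuous_seminorm nrm).measurable.comp
      (measurable_fst.sub measurable_snd))
  -- Several samples may coincide, so the constant attached to a point is the least one. Off the
  -- samples it is `⊤`, which costs nothing as the empirical distribution ignores those points.
  set m : (Fin T → ℝ) → ℝ≥0∞ := fun ζ => ⨅ i, if ζ = xiHat i then c i else ⊤ with hm
  have hmm : Measurable m := Measurable.iInf fun i =>
    Measurable.ite (measurableSet_singleton (xiHat i)) measurable_const measurable_const
  have hae : ∀ᵐ z ∂π, z.1 ∈ Ξ := by
    have h1 : ∀ᵐ ξ ∂(π.map Prod.fst), ξ ∈ Ξ := by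
      rw [ae_iff]; exact hfst
    exact ae_of_ae_map measurable_fst.aemeasurable h1
  calc ∫⁻ ξ, f ξ ∂(π.map Prod.fst) = ∫⁻ z, f z.1 ∂π := lintegral_map hf measurable_fst
    _ ≤ ∫⁻ z, (l * ENNReal.ofReal (nrm (z.1 - z.2)) + m z.2) ∂π := by
      refine lintegral_mono_ae ?_
      filter_upwards [hae] with z hz
      rw [hm]
      simp only
      rw [ENNReal.add_iInf]
      refine le_iInf fun i => ?_
      split_ifs with hi
      · rw [hi]; exact h i z.1 hz
      · simp
    _ = l * ∫⁻ z, ENNReal.ofReal (nrm (z.1 - z.2)) ∂π + ∫⁻ ζ, m ζ ∂(π.map Prod.snd) := by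
      rw [lintegral_add_left (hn.const_mul l), lintegral_const_mul l hn,
        lintegral_map hmm measurable_snd]
    _ ≤ _ := by
      rw [hsnd, lintegral_empirical]
      gcongr with i
      exact (iInf_le _ i).trans (by simp)

theorem worstCaseCVaR_nonpos_of_conicConstraints {T I K : ℕ} (hI : 0 < I)
    (nrm : Seminorm ℝ (Fin T → ℝ)) (hnrm : ∀ x, nrm x = 0 → x = 0)
    (C : Matrix (Fin K) (Fin T) ℝ) (d : Fin K → ℝ) (xiHat : Fin I → Fin T → ℝ)
    (ρ : ℝ) (hρ : 0 ≤ ρ) (ε : ℝ) (hε : 0 < ε) (D μ : Fin T → ℝ) (x : ℝ) (t : Fin T)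
    (τ lam : ℝ) (s : Fin I → ℝ) (γ : Fin I → Fin K → ℝ)
    (h : ConicConstraints nrm C d xiHat ρ ε D μ x t τ lam s γ) :
    worstCaseCVaR (ambiguitySet nrm (polytope C d) xiHat ρ) ε
      (fun ξ => D t * (μ t + ξ t) - x) ≤ 0 := by
  have hlam := h.lam_nonneg hε hI
  have hI' : (0 : ℝ) < I := by exact_mod_cast hI
  have hsum : ∑ i, (s i - τ) = ∑ i, s i - I * τ := by
    rw [Finset.sum_sub_distrib]; simp
  have hsum0 : 0 ≤ ∑ i, (s i - τ) := Finset.sum_nonneg fun i _ => sub_nonneg.mpr (h.2 i).1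
  have havg : (1 / (I : ℝ)) * ∑ i, (s i - τ) = (1 / (I : ℝ)) * ∑ i, s i - τ := by
    rw [hsum]; field_simp
  have havg0 : 0 ≤ (1 / (I : ℝ)) * ∑ i, (s i - τ) := by positivity
  have hτ : τ ≤ 0 := by
    have := mul_nonneg hlam hρ
    linarith [h.1]
  refine iSup₂_le fun P hP => ?_
  obtain ⟨-, hsupp, hW⟩ := hP
  have hint : ∫⁻ ξ, ENNReal.ofReal (D t * (μ t + ξ t) - x - τ) ∂P ≤ ENNReal.ofReal (ε * -τ) := by
    have hδ : ∀ δ > 0, ∫⁻ ξ, ENNReal.ofReal (D t * (μ t + ξ t) - x - τ) ∂P ≤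
        ENNReal.ofReal (ε * lam * δ + ε * -τ) := by
      intro δ hδ
      have hlt : wasserstein nrm P (empirical xiHat) < ENNReal.ofReal (ρ + δ) :=
        hW.trans_lt ((ENNReal.ofReal_lt_ofReal_iff (by linarith)).mpr (by linarith))
      simp only [wasserstein, iInf_lt_iff] at hlt
      obtain ⟨π, ⟨hfst, hsnd⟩, hcost⟩ := hlt
      have h1 := lintegral_le_of_coupling nrm (polytope C d) xiHat π (by rwa [hfst]) hsnd
        (fun ξ => ENNReal.ofReal (D t * (μ t + ξ t) - x - τ)) (by fun_prop)
        (ENNReal.ofReal (ε * lam)) (fun i => ENNReal.ofReal (ε * (s i - τ))) (by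
          intro i ξ hξ
          rw [← ENNReal.ofReal_mul (by positivity), ← ENNReal.ofReal_add (by positivity)
            (mul_nonneg hε.le (sub_nonneg.mpr (h.2 i).1))]
          exact ENNReal.ofReal_le_ofReal (h.excess_le hnrm hε i ξ hξ))
      rw [hfst] at h1
      refine h1.trans ?_
      have hIinv : (I : ℝ≥0∞)⁻¹ = ENNReal.ofReal (1 / (I : ℝ)) := by
        rw [one_div, ENNReal.ofReal_inv_of_pos hI', ENNReal.ofReal_natCast]
      calc _ ≤ ENNReal.ofReal (ε * lam) * ENNReal.ofReal (ρ + δ)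
            + (I : ℝ≥0∞)⁻¹ * ∑ i, ENNReal.ofReal (ε * (s i - τ)) := by gcongr
        _ = ENNReal.ofReal (ε * lam * (ρ + δ) + 1 / (I : ℝ) * ∑ i, ε * (s i - τ)) := by
          rw [← ENNReal.ofReal_mul (by positivity), hIinv, ← ENNReal.ofReal_sum_of_nonneg
            (fun i _ => mul_nonneg hε.le (sub_nonneg.mpr (h.2 i).1)),
            ← ENNReal.ofReal_mul (by positivity), ← ENNReal.ofReal_add (by positivity)]
          rw [← Finset.mul_sum]
          positivity
        _ ≤ _ := by
          refine ENNReal.ofReal_le_ofReal ?_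
          rw [← Finset.mul_sum, mul_left_comm, havg]
          have := mul_le_mul_of_nonneg_left h.1 hε.le
          linarith
    have hlim : Filter.Tendsto (fun δ : ℝ => ENNReal.ofReal (ε * lam * δ + ε * -τ))
        (nhdsWithin 0 (Set.Ioi 0)) (nhds (ENNReal.ofReal (ε * -τ))) := by
      have hcont : Continuous fun δ : ℝ => ENNReal.ofReal (ε * lam * δ + ε * -τ) :=
        ENNReal.continuous_ofReal.comp (by fun_prop)
      simpa using (hcont.tendsto 0).mono_left nhdsWithin_le_nhds
    exact ge_of_tendsto hlim (Filter.eventually_of_mem self_mem_nhdsWithin hδ)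
  refine (iInf_le _ τ).trans ?_
  have hE : (ENNReal.ofReal ε)⁻¹ * ∫⁻ ξ, ENNReal.ofReal (D t * (μ t + ξ t) - x - τ) ∂P
      ≤ ENNReal.ofReal (-τ) := by
    rw [ENNReal.inv_mul_le_iff (by simpa using hε) ENNReal.ofReal_ne_top,
      ← ENNReal.ofReal_mul hε.le]
    exact hint
  calc _ ≤ (τ : EReal) + ((ENNReal.ofReal (-τ) : ℝ≥0∞) : EReal) := by
        gcongr
        exact_mod_cast hE
    _ = 0 := by
      rw [EReal.coe_ennreal_ofReal, max_eq_left (by linarith), ← EReal.coe_add]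
      simp

/-! ### Discrete distributions in the ambiguity set -/

/-- The distribution obtained from the empirical one by moving mass `a i` from the sample
`xiHat i` to the point `ζ i`. -/
noncomputable def movedMass {T I : ℕ} (xiHat ζ : Fin I → Fin T → ℝ) (a : Fin I → ℝ) :
    Measure (Fin T → ℝ) :=
  ∑ i, (ENNReal.ofReal (1 / I - a i) • Measure.dirac (xiHat i) +
    ENNReal.ofReal (a i) • Measure.dirac (ζ i))

lemma movedMass_mem_ambiguitySet {T I : ℕ} (hI : 0 < I) (nrm : Seminorm ℝ (Fin T → ℝ))
    (Ξ : Set (Fin T → ℝ)) (xiHat : Fin I → Fin T → ℝ) (hxi : ∀ i, xiHat i ∈ Ξ) (ρ : ℝ)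
    (ζ : Fin I → Fin T → ℝ) (hζ : ∀ i, ζ i ∈ Ξ) (a : Fin I → ℝ) (ha0 : ∀ i, 0 ≤ a i)
    (ha1 : ∀ i, a i ≤ 1 / I) (hcost : ∑ i, a i * nrm (ζ i - xiHat i) ≤ ρ) :
    movedMass xiHat ζ a ∈ ambiguitySet nrm Ξ xiHat ρ := by
  have hI' : (0 : ℝ) < I := by exact_mod_cast hI
  have hmass : ∀ i, ENNReal.ofReal (1 / I - a i) + ENNReal.ofReal (a i) = (I : ℝ≥0∞)⁻¹ := by
    intro i
    rw [← ENNReal.ofReal_add (sub_nonneg.mpr (ha1 i)) (ha0 i), sub_add_cancel, one_div,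
      ENNReal.ofReal_inv_of_pos hI', ENNReal.ofReal_natCast]
  refine ⟨⟨?_⟩, ?_, ?_⟩
  · simp only [movedMass, Measure.finsetSum_apply, Measure.add_apply, Measure.smul_apply,
      measure_univ, smul_eq_mul, mul_one, hmass, Finset.sum_const, Finset.card_univ,
      Fintype.card_fin, nsmul_eq_mul]
    exact ENNReal.mul_inv_cancel (by exact_mod_cast hI.ne') (ENNReal.natCast_ne_top I)
  · simp [movedMass, Measure.finsetSum_apply, hxi, hζ]
  · set π : Measure ((Fin T → ℝ) × (Fin T → ℝ)) :=
      ∑ i, (ENNReal.ofReal (1 / I - a i) • Measure.dirac (xiHat i, xiHat i) +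
        ENNReal.ofReal (a i) • Measure.dirac (ζ i, xiHat i)) with hπ
    have hmap : ∀ g : (Fin T → ℝ) × (Fin T → ℝ) → (Fin T → ℝ), Measurable g →
        π.map g = ∑ i, (ENNReal.ofReal (1 / I - a i) • Measure.dirac (g (xiHat i, xiHat i)) +
          ENNReal.ofReal (a i) • Measure.dirac (g (ζ i, xiHat i))) := by
      intro g hg
      rw [hπ, ← Measure.mapₗ_apply_of_measurable hg, map_sum]
      refine Finset.sum_congr rfl fun i _ => ?_
      rw [Measure.mapₗ_apply_of_measurable hg, Measure.map_add _ _ hg, Measure.map_smul,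
        Measure.map_smul, Measure.map_dirac' hg, Measure.map_dirac' hg]
    refine (iInf₂_le π ⟨hmap _ measurable_fst, ?_⟩).trans ?_
    rotate_left
    · rw [hmap _ measurable_snd, empirical, Finset.smul_sum]
      refine Finset.sum_congr rfl fun i _ => ?_
      rw [← add_smul, hmass]
    · rw [hπ, lintegral_finsetSum_measure]
      simp only [lintegral_add_measure, lintegral_smul_measure, lintegral_dirac, sub_self,
        map_zero, ENNReal.ofReal_zero, smul_eq_mul, mul_zero, zero_add]
      simp only [← ENNReal.ofReal_mul (ha0 _)]
      rw [← ENNReal.ofReal_sum_of_nonneg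
        (fun i _ => mul_nonneg (ha0 i) (apply_nonneg nrm _))]
      exact ENNReal.ofReal_le_ofReal hcost

/-- The average loss over any part of mass `ε` of a distribution, here over the moved mass, is at
most the conditional value-at-risk. -/
lemma sum_mul_nonpos_of_cvar_movedMass_nonpos {T I : ℕ} (xiHat ζ : Fin I → Fin T → ℝ)
    (a : Fin I → ℝ) (ha0 : ∀ i, 0 ≤ a i) (ε : ℝ) (hε : 0 < ε) (hsum : ∑ i, a i = ε)
    (L : (Fin T → ℝ) → ℝ) (h : cvar (movedMass xiHat ζ a) ε L ≤ 0) :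
    ∑ i, a i * L (ζ i) ≤ 0 := by
  by_contra! hcon
  have hlt : cvar (movedMass xiHat ζ a) ε L < ((∑ i, a i * L (ζ i)) / ε : ℝ) :=
    h.trans_lt (by exact_mod_cast div_pos hcon hε)
  rw [cvar, iInf_lt_iff] at hlt
  obtain ⟨β, hβ⟩ := hlt
  refine absurd hβ (not_lt.mpr ?_)
  have hint : ENNReal.ofReal (∑ i, a i * L (ζ i) - ε * β) ≤
      ∫⁻ ω, ENNReal.ofReal (L ω - β) ∂(movedMass xiHat ζ a) := by
    rw [movedMass, lintegral_finsetSum_measure]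
    simp only [lintegral_add_measure, lintegral_smul_measure, lintegral_dirac, smul_eq_mul]
    calc ENNReal.ofReal (∑ i, a i * L (ζ i) - ε * β)
        ≤ ENNReal.ofReal (∑ i, a i * max (L (ζ i) - β) 0) := by
          refine ENNReal.ofReal_le_ofReal ?_
          rw [← hsum, Finset.sum_mul, ← Finset.sum_sub_distrib]
          refine Finset.sum_le_sum fun i _ => ?_
          rw [← mul_sub]
          exact mul_le_mul_of_nonneg_left (le_max_left _ _) (ha0 i)
      _ = ∑ i, ENNReal.ofReal (a i) * ENNReal.ofReal (L (ζ i) - β) := by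
          rw [ENNReal.ofReal_sum_of_nonneg
            (fun i _ => mul_nonneg (ha0 i) (le_max_right _ _))]
          refine Finset.sum_congr rfl fun i _ => ?_
          rw [ENNReal.ofReal_mul (ha0 i), ENNReal.ofReal_max, ENNReal.ofReal_zero,
            max_eq_left zero_le]
      _ ≤ _ := Finset.sum_le_sum fun i _ => le_add_self
  have hdiv : ENNReal.ofReal ((∑ i, a i * L (ζ i)) / ε - β) ≤
      (ENNReal.ofReal ε)⁻¹ * ∫⁻ ω, ENNReal.ofReal (L ω - β) ∂(movedMass xiHat ζ a) := by
    have : (∑ i, a i * L (ζ i)) / ε - β = ε⁻¹ * (∑ i, a i * L (ζ i) - ε * β) := by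
      field_simp
    rw [this, ENNReal.ofReal_mul (by positivity), ENNReal.ofReal_inv_of_pos hε]
    gcongr
  calc (((∑ i, a i * L (ζ i)) / ε : ℝ) : EReal)
      ≤ (β : EReal) + ((ENNReal.ofReal ((∑ i, a i * L (ζ i)) / ε - β) : ℝ≥0∞) : EReal) := by
        rw [EReal.coe_ennreal_ofReal, ← EReal.coe_add, EReal.coe_le_coe_iff]
        linarith [le_max_left ((∑ i, a i * L (ζ i)) / ε - β) 0]
    _ ≤ _ := by
        gcongr
        exact_mod_cast hdiv

/-! ### The finite-dimensional transport problem and its dual -/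

/-- The pairs `(a, z)` of masses `a i` taken away from the samples, of total mass `ε`, and of
displacements `z i` multiplied by these masses. If `a i ≠ 0`, then the last condition says that
`xiHat i + z i / a i` lies in the polytope; if `a i = 0`, that `z i` is a recession direction. -/
def transportPlans {T I K : ℕ} (C : Matrix (Fin K) (Fin T) ℝ) (d : Fin K → ℝ)
    (xiHat : Fin I → Fin T → ℝ) (ε : ℝ) : Set ((Fin I → ℝ) × (Fin I → Fin T → ℝ)) :=
  {w | (∀ i, 0 ≤ w.1 i) ∧ (∀ i, w.1 i ≤ 1 / I) ∧ ∑ i, w.1 i = ε ∧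
    ∀ i k, (C *ᵥ w.2 i) k ≤ w.1 i * (d - C *ᵥ xiHat i) k}

/-- The cost `∑ i, ‖z i‖` of a transport plan `(a, z)`. -/
noncomputable def transportCost {T I : ℕ} (nrm : Seminorm ℝ (Fin T → ℝ)) :
    Seminorm ℝ ((Fin I → ℝ) × (Fin I → Fin T → ℝ)) :=
  Seminorm.of (fun w => ∑ i, nrm (w.2 i))
    (fun v w => by
      rw [← Finset.sum_add_distrib]
      exact Finset.sum_le_sum fun i _ => map_add_le_add nrm _ _)
    (fun c w => by
      rw [Finset.mul_sum]
      exact Finset.sum_congr rfl fun i _ => map_smul_eq_mul nrm _ _)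

lemma transportCost_apply {T I : ℕ} (nrm : Seminorm ℝ (Fin T → ℝ))
    (w : (Fin I → ℝ) × (Fin I → Fin T → ℝ)) : transportCost nrm w = ∑ i, nrm (w.2 i) := rfl

lemma continuous_transportCost {T I : ℕ} (nrm : Seminorm ℝ (Fin T → ℝ)) :
    Continuous (transportCost (I := I) nrm) := by
  have h : ∀ i : Fin I, Continuous fun w : (Fin I → ℝ) × (Fin I → Fin T → ℝ) => nrm (w.2 i) :=
    fun i => (continuous_seminorm nrm).comp (by fun_prop)
  exact (continuous_finsetSum Finset.univ fun i _ => h i :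
    Continuous fun w : (Fin I → ℝ) × (Fin I → Fin T → ℝ) => ∑ i, nrm (w.2 i))

/-- The loss `∑ i, (a i * ℓ i + δ * z i t)` carried by a transport plan `(a, z)`, where `ℓ i` is
the loss at the sample `xiHat i` and `δ` is the slope of the loss in the coordinate `t`. -/
def transportLoss {T I : ℕ} (ℓ : Fin I → ℝ) (δ : ℝ) (t : Fin T) :
    ((Fin I → ℝ) × (Fin I → Fin T → ℝ)) →ₗ[ℝ] ℝ where
  toFun w := ∑ i, (w.1 i * ℓ i + δ * w.2 i t)
  map_add' v w := by
    rw [← Finset.sum_add_distrib]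
    refine Finset.sum_congr rfl fun i _ => ?_
    simp only [Prod.fst_add, Prod.snd_add, Pi.add_apply]
    ring
  map_smul' c w := by
    rw [RingHom.id_apply, smul_eq_mul, Finset.mul_sum]
    refine Finset.sum_congr rfl fun i _ => ?_
    simp only [Prod.smul_fst, Prod.smul_snd, Pi.smul_apply, smul_eq_mul]
    ring

lemma transportLoss_apply {T I : ℕ} (ℓ : Fin I → ℝ) (δ : ℝ) (t : Fin T)
    (w : (Fin I → ℝ) × (Fin I → Fin T → ℝ)) :
    transportLoss ℓ δ t w = ∑ i, (w.1 i * ℓ i + δ * w.2 i t) := rfl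

lemma convex_transportPlans {T I K : ℕ} (C : Matrix (Fin K) (Fin T) ℝ) (d : Fin K → ℝ)
    (xiHat : Fin I → Fin T → ℝ) (ε : ℝ) : Convex ℝ (transportPlans C d xiHat ε) := by
  rintro v ⟨h1, h2, h3, h4⟩ w ⟨k1, k2, k3, k4⟩ a b ha hb hab
  refine ⟨fun i => ?_, fun i => ?_, ?_, fun i k => ?_⟩
  · exact add_nonneg (mul_nonneg ha (h1 i)) (mul_nonneg hb (k1 i))
  · calc a * v.1 i + b * w.1 i ≤ a * (1 / I) + b * (1 / I) := by
          gcongr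
          · exact h2 i
          · exact k2 i
      _ = 1 / I := by rw [← add_mul, hab, one_mul]
  · calc ∑ i, (a * v.1 i + b * w.1 i) = a * ∑ i, v.1 i + b * ∑ i, w.1 i := by
          rw [Finset.sum_add_distrib, Finset.mul_sum, Finset.mul_sum]
      _ = ε := by rw [h3, k3, ← add_mul, hab, one_mul]
  · simp only [Prod.fst_add, Prod.snd_add, Prod.smul_fst, Prod.smul_snd, Pi.add_apply,
      Pi.smul_apply, Matrix.mulVec_add, Matrix.mulVec_smul, smul_eq_mul]
    calc _ ≤ a * (v.1 i * (d - C *ᵥ xiHat i) k) + b * (w.1 i * (d - C *ᵥ xiHat i) k) := by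
          gcongr
          · exact h4 i k
          · exact k4 i k
      _ = _ := by ring

/-- The plan that displaces nothing and takes the same mass from all samples. -/
lemma uniform_mem_transportPlans {T I K : ℕ} (hI : 0 < I) (C : Matrix (Fin K) (Fin T) ℝ)
    (d : Fin K → ℝ) (xiHat : Fin I → Fin T → ℝ) (hxi : ∀ i, xiHat i ∈ polytope C d)
    (ε : ℝ) (hε : 0 < ε) (hε1 : ε < 1) :
    ((fun _ => ε / I, 0) : (Fin I → ℝ) × (Fin I → Fin T → ℝ)) ∈
      transportPlans C d xiHat ε := by
  have hI' : (0 : ℝ) < I := by exact_mod_cast hI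
  refine ⟨fun i => by positivity, fun i => ?_, ?_, fun i k => ?_⟩
  · exact div_le_div_of_nonneg_right hε1.le hI'.le
  · simp; field_simp
  · simp only [Pi.zero_apply, Matrix.mulVec_zero]
    exact mul_nonneg (by positivity) (sub_nonneg.mpr (hxi i k))

/-- If the worst-case conditional value-at-risk is nonpositive, then so is the loss of every
transport plan within the budget `ρ`. A plan with `0 < a i` for all `i` is a distribution in the
ambiguity set; the other ones are limits of such plans. -/
lemma transportLoss_nonpos {T I K : ℕ} (hI : 0 < I) (nrm : Seminorm ℝ (Fin T → ℝ))
    (C : Matrix (Fin K) (Fin T) ℝ) (d : Fin K → ℝ) (xiHat : Fin I → Fin T → ℝ)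
    (hxi : ∀ i, xiHat i ∈ polytope C d) (ρ : ℝ) (ε : ℝ) (hε : 0 < ε) (hε1 : ε < 1)
    (D μ : Fin T → ℝ) (x : ℝ) (t : Fin T)
    (h : worstCaseCVaR (ambiguitySet nrm (polytope C d) xiHat ρ) ε
      (fun ξ => D t * (μ t + ξ t) - x) ≤ 0)
    (w : (Fin I → ℝ) × (Fin I → Fin T → ℝ)) (hw : w ∈ transportPlans C d xiHat ε)
    (hwρ : transportCost nrm w ≤ ρ) :
    transportLoss (fun i => D t * (μ t + xiHat i t) - x) (D t) t w ≤ 0 := by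
  have hpos : ∀ w ∈ transportPlans C d xiHat ε, (∀ i, 0 < w.1 i) → transportCost nrm w ≤ ρ →
      transportLoss (fun i => D t * (μ t + xiHat i t) - x) (D t) t w ≤ 0 := by
    rintro ⟨a, z⟩ ⟨h1, h2, h3, h4⟩ ha hwρ
    simp only at h1 h2 h3 h4 ha
    have hmem := movedMass_mem_ambiguitySet hI nrm (polytope C d) xiHat hxi ρ
      (fun i => xiHat i + (a i)⁻¹ • z i) (by
        intro i k
        have h5 := h4 i k
        rw [Pi.sub_apply, ← inv_mul_le_iff₀ (ha i)] at h5
        rw [Matrix.mulVec_add, Matrix.mulVec_smul, Pi.add_apply, Pi.smul_apply, smul_eq_mul]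
        linarith) a h1 h2 (by
        refine le_trans (le_of_eq ?_) hwρ
        rw [transportCost_apply]
        refine Finset.sum_congr rfl fun i _ => ?_
        rw [add_sub_cancel_left, map_smul_eq_mul, Real.norm_of_nonneg (inv_nonneg.mpr (h1 i)),
          mul_inv_cancel_left₀ (ha i).ne'])
    have hc := sum_mul_nonpos_of_cvar_movedMass_nonpos xiHat _ a h1 ε hε h3 _
      ((le_iSup₂ (f := fun P (_ : P ∈ ambiguitySet nrm (polytope C d) xiHat ρ) =>
        cvar P ε (fun ξ => D t * (μ t + ξ t) - x)) _ hmem).trans h)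
    refine le_trans (le_of_eq ?_) hc
    rw [transportLoss_apply]
    refine Finset.sum_congr rfl fun i _ => ?_
    simp only [Pi.add_apply, Pi.smul_apply, smul_eq_mul]
    have := (ha i).ne'
    field_simp
    ring
  set f := transportLoss (fun i => D t * (μ t + xiHat i t) - x) (D t) t
  set w₀ : (Fin I → ℝ) × (Fin I → Fin T → ℝ) := (fun _ => ε / I, 0) with hw₀
  have hw₀mem : w₀ ∈ transportPlans C d xiHat ε :=
    uniform_mem_transportPlans hI C d xiHat hxi ε hε hε1
  have hcost₀ : transportCost nrm w₀ = 0 := by simp [transportCost_apply, hw₀]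
  have hI' : (0 : ℝ) < I := by exact_mod_cast hI
  have hmix : ∀ δ ∈ Set.Ioo (0 : ℝ) 1, (1 - δ) * f w + δ * f w₀ ≤ 0 := by
    rintro δ ⟨hδ0, hδ1⟩
    have := hpos ((1 - δ) • w + δ • w₀)
      (convex_transportPlans C d xiHat ε hw hw₀mem (by linarith) hδ0.le (by ring))
      (fun i => add_pos_of_nonneg_of_pos (mul_nonneg (by linarith) (hw.1 i))
        (mul_pos hδ0 (div_pos hε hI')))
      (by
        refine (map_add_le_add _ _ _).trans ?_
        rw [map_smul_eq_mul, map_smul_eq_mul, hcost₀, mul_zero, add_zero,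
          Real.norm_of_nonneg (by linarith)]
        exact (mul_le_of_le_one_left (apply_nonneg _ _) (by linarith)).trans hwρ)
    rwa [map_add, map_smul, map_smul, smul_eq_mul, smul_eq_mul] at this
  have hlim : Filter.Tendsto (fun δ : ℝ => (1 - δ) * f w + δ * f w₀)
      (nhdsWithin 0 (Set.Ioi 0)) (nhds (f w)) := by
    have hcont : Continuous fun δ : ℝ => (1 - δ) * f w + δ * f w₀ := by fun_prop
    simpa using (hcont.tendsto 0).mono_left nhdsWithin_le_nhds
  exact le_of_tendsto hlim (Filter.eventually_of_mem (Ioo_mem_nhdsGT one_pos) hmix)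

/-- The dual of the transport problem with the cost in the objective: `σ i` is the
multiplier of `a i ≤ 1 / I`, `θ` that of `∑ i, a i = ε`, and `γ i` that of the polytope constraints
on `z i`. -/
lemma exists_transport_multipliers {T I K : ℕ} (hI : 0 < I) (nrm : Seminorm ℝ (Fin T → ℝ))
    (C : Matrix (Fin K) (Fin T) ℝ) (d : Fin K → ℝ) (xiHat : Fin I → Fin T → ℝ)
    (hxi : ∀ i, xiHat i ∈ polytope C d) (ε : ℝ) (hε : 0 < ε) (hε1 : ε < 1)
    (ℓ : Fin I → ℝ) (δ : ℝ) (t : Fin T) (lam r : ℝ) (hlam : 0 ≤ lam)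
    (h : ∀ w ∈ transportPlans C d xiHat ε,
      transportLoss ℓ δ t w - lam * transportCost nrm w ≤ r) :
    ∃ (θ : ℝ) (σ : Fin I → ℝ) (γ : Fin I → Fin K → ℝ), (∀ i, 0 ≤ σ i) ∧ (∀ i, 0 ≤ γ i) ∧
      (∀ i, ℓ i + γ i ⬝ᵥ (d - C *ᵥ xiHat i) ≤ σ i + θ) ∧
      (∀ i v, δ * v t - γ i ⬝ᵥ (C *ᵥ v) ≤ lam * nrm v) ∧
      ε * θ + (1 / (I : ℝ)) * ∑ i, σ i ≤ r := by
  classical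
  let mass : Fin I → (Fin I → ℝ) × (Fin I → Fin T → ℝ) →ₗ[ℝ] ℝ :=
    fun i => (LinearMap.proj i).comp (LinearMap.fst ℝ _ _)
  let disp : Fin I → (Fin I → ℝ) × (Fin I → Fin T → ℝ) →ₗ[ℝ] (Fin T → ℝ) :=
    fun i => (LinearMap.proj i).comp (LinearMap.snd ℝ _ _)
  let φ : Fin I ⊕ Fin I ⊕ Unit ⊕ Unit ⊕ Fin I × Fin K →
      (Fin I → ℝ) × (Fin I → Fin T → ℝ) →ₗ[ℝ] ℝ :=
    Sum.elim (fun i => -mass i) <| Sum.elim mass <| Sum.elim (fun _ => ∑ i, mass i) <|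
      Sum.elim (fun _ => -∑ i, mass i) fun q =>
        (LinearMap.proj q.2).comp ((Matrix.mulVecLin C).comp (disp q.1)) -
          (d - C *ᵥ xiHat q.1) q.2 • mass q.1
  let c : Fin I ⊕ Fin I ⊕ Unit ⊕ Unit ⊕ Fin I × Fin K → ℝ :=
    Sum.elim (fun _ => 0) <| Sum.elim (fun _ => 1 / (I : ℝ)) <| Sum.elim (fun _ => ε) <|
      Sum.elim (fun _ => -ε) fun _ => 0
  have hmass : ∀ i w, mass i w = w.1 i := fun _ _ => rfl
  have hφ : ∀ w, w ∈ transportPlans C d xiHat ε ↔ ∀ k, φ k w ≤ c k := by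
    intro w
    have hq : ∀ i k, φ (.inr (.inr (.inr (.inr (i, k))))) w =
        (C *ᵥ w.2 i) k - (d - C *ᵥ xiHat i) k * w.1 i := fun _ _ => rfl
    have hs : (∑ i, mass i) w = ∑ i, w.1 i := by simp [LinearMap.sum_apply, hmass]
    constructor
    · rintro ⟨h1, h2, h3, h4⟩ (i | i | _ | _ | ⟨i, k⟩)
      · exact neg_nonpos.mpr (h1 i)
      · exact h2 i
      · exact (hs.trans h3).le
      · exact (congrArg Neg.neg (hs.trans h3)).le
      · rw [hq, mul_comm]; exact sub_nonpos.mpr (h4 i k)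
    · intro hk
      refine ⟨fun i => neg_nonpos.mp (hk (.inl i)), fun i => hk (.inr (.inl i)),
        le_antisymm ?_ ?_, fun i k => ?_⟩
      · rw [← hs]; exact hk (.inr (.inr (.inl ())))
      · rw [← hs]; exact neg_le_neg_iff.mp (hk (.inr (.inr (.inr (.inl ())))))
      · have := hk (.inr (.inr (.inr (.inr (i, k)))))
        rw [hq, mul_comm] at this
        exact sub_nonpos.mp this
  obtain ⟨y, hy, hyw, hyc⟩ := exists_multipliers_of_sub_seminorm_le (transportCost nrm)
    (continuous_transportCost nrm) lam hlam φ c (transportLoss ℓ δ t) r _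
    ((hφ _).mp (uniform_mem_transportPlans hI C d xiHat hxi ε hε hε1))
    (fun w hw => h w ((hφ w).mpr hw))
  set η : Fin I → ℝ := fun i => y (.inl i) with hη
  set σ : Fin I → ℝ := fun i => y (.inr (.inl i)) with hσ
  set θ : ℝ := y (.inr (.inr (.inl ()))) - y (.inr (.inr (.inr (.inl ())))) with hθ
  set γ : Fin I → Fin K → ℝ := fun i k => y (.inr (.inr (.inr (.inr (i, k))))) with hγ
  have hsum : ∀ w, ∑ k, y k * φ k w = ∑ i, ((σ i + θ - η i) * w.1 i +
      (γ i ⬝ᵥ (C *ᵥ w.2 i) - γ i ⬝ᵥ (d - C *ᵥ xiHat i) * w.1 i)) := by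
    intro w
    simp only [Fintype.sum_sum_type, Fintype.sum_prod_type, φ, mass, disp, Sum.elim_inl,
      Sum.elim_inr, LinearMap.neg_apply, LinearMap.sub_apply, LinearMap.smul_apply,
      LinearMap.comp_apply, LinearMap.sum_apply, LinearMap.proj_apply, LinearMap.fst_apply,
      LinearMap.snd_apply, Matrix.mulVecLin_apply, Finset.univ_unique, Finset.sum_singleton,
      smul_eq_mul, PUnit.default_eq_unit]
    simp only [dotProduct, Finset.sum_mul, ← Finset.sum_sub_distrib, Finset.mul_sum,
      ← Finset.sum_add_distrib, ← Finset.sum_neg_distrib]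
    refine Finset.sum_congr rfl fun i _ => ?_
    have : ∑ k, y (.inr (.inr (.inr (.inr (i, k))))) *
        ((C *ᵥ w.2 i) k - (d - C *ᵥ xiHat i) k * w.1 i) =
        ∑ k, (γ i k * (C *ᵥ w.2 i) k - γ i k * (d - C *ᵥ xiHat i) k * w.1 i) :=
      Finset.sum_congr rfl fun k _ => by rw [hγ]; ring
    rw [this, hθ, hσ, hη]
    ring
  refine ⟨θ, σ, γ, fun i => hy _, fun i k => hy _, fun i => ?_, fun i v => ?_, ?_⟩
  · have h1 := hyw (Pi.single i 1, 0)
    rw [hsum, transportLoss_apply, transportCost_apply] at h1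
    simp [Pi.single_apply, Finset.sum_add_distrib] at h1
    have h2 : 0 ≤ η i := hy (.inl i)
    rw [dotProduct_sub]
    linarith
  · have h1 := hyw (0, Pi.single i v)
    rw [hsum, transportLoss_apply, transportCost_apply] at h1
    rw [Fintype.sum_eq_single i (fun j hj => by simp [hj]),
      Fintype.sum_eq_single i (fun j hj => by simp [hj]),
      Fintype.sum_eq_single i (fun j hj => by simp [hj])] at h1
    simpa using h1
  · have h1 : ∑ k, y k * c k = ε * θ + (1 / (I : ℝ)) * ∑ i, σ i := by
      simp only [Fintype.sum_sum_type, c, Sum.elim_inl, Sum.elim_inr, Finset.univ_unique,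
        Finset.sum_singleton, PUnit.default_eq_unit, mul_zero, Finset.sum_const_zero,
        ← Finset.sum_mul]
      rw [hθ]
      ring
    exact h1 ▸ hyc

/-! ### Existence of the conic variables -/

theorem exists_conicConstraints_of_worstCaseCVaR_nonpos {T I K : ℕ} (hI : 0 < I)
    (nrm : Seminorm ℝ (Fin T → ℝ)) (hnrm : ∀ x, nrm x = 0 → x = 0)
    (C : Matrix (Fin K) (Fin T) ℝ) (d : Fin K → ℝ) (xiHat : Fin I → Fin T → ℝ)
    (hxi : ∀ i, xiHat i ∈ polytope C d) (ρ : ℝ) (hρ : 0 ≤ ρ) (ε : ℝ) (hε : 0 < ε) (hε1 : ε < 1)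
    (D μ : Fin T → ℝ) (x : ℝ) (t : Fin T)
    (h : worstCaseCVaR (ambiguitySet nrm (polytope C d) xiHat ρ) ε
      (fun ξ => D t * (μ t + ξ t) - x) ≤ 0) :
    ∃ (τ lam : ℝ) (s : Fin I → ℝ) (γ : Fin I → Fin K → ℝ),
      ConicConstraints nrm C d xiHat ρ ε D μ x t τ lam s γ := by
  have hI' : (0 : ℝ) < I := by exact_mod_cast hI
  set ℓ : Fin I → ℝ := fun i => D t * (μ t + xiHat i t) - x with hℓ
  have hprimal := transportLoss_nonpos hI nrm C d xiHat hxi ρ ε hε hε1 D μ x t h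
  obtain ⟨l, hl, hlw⟩ : ∃ l : ℝ, 0 ≤ l ∧ ∀ w ∈ transportPlans C d xiHat ε,
      transportLoss ℓ (D t) t w - l * transportCost nrm w ≤ -(l * ρ) := by
    rcases hρ.eq_or_lt with rfl | hρ
    · -- Without Slater's condition: a Lipschitz constant of the loss is an exact penalty.
      obtain ⟨c, hc, hcn⟩ := exists_norm_le_mul_seminorm nrm hnrm
      refine ⟨|D t| * c, by positivity, fun w hw => ?_⟩
      have h1 := hprimal (w.1, 0) ⟨hw.1, hw.2.1, hw.2.2.1, fun i k => by
        simpa using mul_nonneg (hw.1 i) (sub_nonneg.mpr (hxi i k))⟩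
        (by simp [transportCost_apply])
      rw [transportLoss_apply] at h1
      simp only [Pi.zero_apply, mul_zero, add_zero] at h1
      have h2 : ∑ i, D t * w.2 i t ≤ |D t| * c * transportCost nrm w := by
        rw [transportCost_apply, Finset.mul_sum]
        refine Finset.sum_le_sum fun i _ => ?_
        calc D t * w.2 i t ≤ |D t| * |w.2 i t| := by rw [← abs_mul]; exact le_abs_self _
          _ ≤ |D t| * (c * nrm (w.2 i)) := by
            gcongr
            exact (norm_le_pi_norm (w.2 i) t).trans (hcn _)
          _ = |D t| * c * nrm (w.2 i) := by ring
      rw [transportLoss_apply, Finset.sum_add_distrib]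
      linarith
    · exact exists_multiplier_of_seminorm_constraint (transportCost nrm) _
        (convex_transportPlans C d xiHat ε) _ ρ hprimal _
        (uniform_mem_transportPlans hI C d xiHat hxi ε hε hε1)
        (by simpa [transportCost_apply] using hρ)
  obtain ⟨θ, σ, γ, hσ, hγ, h1, h2, h3⟩ := exists_transport_multipliers hI nrm C d xiHat hxi ε hε
    hε1 ℓ (D t) t l _ hl hlw
  -- The transport problem has the loss of mass `ε` as its objective, which is `ε` times the tail
  -- average: `l`, `γ i` and `σ i` stand for `ε` times `lam`, `γ i` and `s i - τ`, and `θ` is `τ`.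
  refine ⟨θ, l / ε, fun i => θ + σ i / ε, fun i => ε⁻¹ • γ i, ?_, fun i => ⟨?_, ?_, ?_, ?_⟩⟩
  · have h4 : (1 / (I : ℝ)) * ∑ i, (θ + σ i / ε) = (ε * θ + (1 / (I : ℝ)) * ∑ i, σ i) / ε := by
      rw [Finset.sum_add_distrib, ← Finset.sum_div]
      simp
      field_simp
    rw [h4, div_mul_eq_mul_div, ← add_div]
    exact div_nonpos_of_nonpos_of_nonneg (by linarith) hε.le
  · have := div_nonneg (hσ i) hε.le
    linarith
  · have h4 := h1 i
    rw [smul_dotProduct, smul_eq_mul, mul_inv_cancel_left₀ hε.ne', mul_add,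
      mul_div_cancel₀ _ hε.ne']
    simp only [hℓ] at h4
    linarith
  · rw [mul_div_cancel₀ _ hε.ne', Matrix.mulVec_smul, smul_inv_smul₀ hε.ne']
    refine dualNorm_le nrm _ l hl fun v => ?_
    have h4 := h2 i (-v)
    rw [Matrix.mulVec_neg, dotProduct_neg, map_neg_eq_map, Pi.neg_apply] at h4
    rw [sub_dotProduct, diagonal_dotProduct, Matrix.mulVec_transpose,
      ← Matrix.dotProduct_mulVec]
    linarith
  · exact smul_nonneg (by positivity) (hγ i)

end WorstCaseCVaR

theorem proposition2
    {N T I K : ℕ} (hI : 0 < I)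
    (nrm : Seminorm ℝ (Fin T → ℝ)) (hnrm : ∀ x, nrm x = 0 → x = 0)
    (C : Matrix (Fin K) (Fin T) ℝ) (d : Fin K → ℝ)
    (xiHat : Fin N → Fin I → Fin T → ℝ)
    (hxi : ∀ n i, xiHat n i ∈ WorstCaseCVaR.polytope C d)
    (ρ : ℝ) (hρ : 0 ≤ ρ)
    (ε : Fin N → ℝ) (hε : ∀ n, 0 < ε n ∧ ε n < 1)
    (D μ p q pb ps Pe : Fin N → Fin T → ℝ) :
    (∀ n t,
      WorstCaseCVaR.worstCaseCVaR
          (WorstCaseCVaR.ambiguitySet nrm (WorstCaseCVaR.polytope C d) (xiHat n) ρ) (ε n)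
          (fun ξ => D n t * (μ n t + ξ t) - (p n t + q n t + pb n t - ps n t + Pe n t)) ≤ 0 ↔
        ∃ (τ lam : ℝ) (s : Fin I → ℝ) (γ : Fin I → Fin K → ℝ),
          WorstCaseCVaR.ConicConstraints nrm C d (xiHat n) ρ (ε n) (D n) (μ n)
            (p n t + q n t + pb n t - ps n t + Pe n t) t τ lam s γ) ∧
    ((∀ n t,
      WorstCaseCVaR.worstCaseCVaR
          (WorstCaseCVaR.ambiguitySet nrm (WorstCaseCVaR.polytope C d) (xiHat n) ρ) (ε n)
          (fun ξ => D n t * (μ n t + ξ t) - (p n t + q n t + pb n t - ps n t + Pe n t)) ≤ 0) ↔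
        ∃ (τ lam : Fin N → Fin T → ℝ) (s : Fin N → Fin I → Fin T → ℝ)
          (γ : Fin N → Fin I → Fin T → Fin K → ℝ),
          ∀ n t, WorstCaseCVaR.ConicConstraints nrm C d (xiHat n) ρ (ε n) (D n) (μ n)
            (p n t + q n t + pb n t - ps n t + Pe n t) t (τ n t) (lam n t)
            (fun i => s n i t) (fun i => γ n i t)) := by
  have key := fun n t =>
    (⟨fun h => WorstCaseCVaR.exists_conicConstraints_of_worstCaseCVaR_nonpos hI nrm hnrm C d
      (xiHat n) (hxi n) ρ hρ (ε n) (hε n).1 (hε n).2 (D n) (μ n)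
      (p n t + q n t + pb n t - ps n t + Pe n t) t h,
    fun ⟨τ, lam, s, γ, h⟩ => WorstCaseCVaR.worstCaseCVaR_nonpos_of_conicConstraints hI nrm hnrm C
      d (xiHat n) ρ hρ (ε n) (hε n).1 (D n) (μ n) _ t τ lam s γ h⟩ : _ ↔ _)
  refine ⟨key, fun h => ?_, fun ⟨τ, lam, s, γ, h⟩ n t => (key n t).mpr ⟨_, _, _, _, h n t⟩⟩
  choose τ lam s γ hc using fun n t => (key n t).mp (h n t)
  exact ⟨τ, lam, fun n i t => s n t i, fun n i t => γ n t i, hc⟩
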